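/- Let $c$ be the real Banach space of convergent real sequences $x=(x_n)_{n\ge 1}$ with the supremum norm. Let $K=\mathbb N\cup\{\infty\}$ be the one-point compactification of the discrete space $\mathbb N=\{1,2,\dots\}$, let $M(K)=C(K)^*$, let $\delta_k\in M(K)$ be the Dirac measure at $k\in K$, and identify $c$ with $C(K)$ by the isometric isomorphism under which $x\in c$ corresponds to the continuous function taking the value $x_n$ at each $n\in\mathbb N$ (and $\lim_n x_n$ at $\infty$). All spaces are real. A linear isometry $T\colon X\to Y$ between Banach spaces is a U-embedding if for every $x^*\in X^*$ with $\|x^*\|=1$ there is exactly one $y^*\in Y^*$ with $y^*\circ T=x^*$ and $\|y^*\|=\|x^*\|$. A Banach space is polyhedral if the closed unit ball of each of its finite-dimensional subspaces is a polytope (the convex hull of a finite set). Then $c$ is not polyhedral, and $c$ can be U-embedded into $C[0,1]$, that is, there is a U-embedding $T\colon c\to C[0,1]$. Moreover, $T$ can be chosen of the form $(Tx)(t)=\langle x,F(t)\rangle$, where $F\colon[0,1]\to B_{M(K)}$ is $w^*$-continuous, $F(0)=\delta_\infty$, $F(1/n)=\delta_n$ for every $n\ge1$, and where, for suitable $p_n\in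 M(K)$ with $\|p_n\|<1$, $F$ runs on each interval $[1/(n+1),1/n]$ along the quadratic Bézier curve with control points $\delta_{n+1}$, $p_n$, $\delta_n$: $$F\Big(\frac{1-s}{n+1}+\frac{s}{n}\Big)=(1-s)^2\,\delta_{n+1}+2s(1-s)\,p_n+s^2\,\delta_n\qquad(0\le s\le 1,\ n\ge 1).$$ -/

import Mathlib

open Set Filter Topology
open scoped BoundedContinuousFunction unitInterval

/-- The real Banach space `c` of convergent real sequences, with the supremum norm
(inherited from the space of all bounded sequences). -/
def ConvSeq : Submodule ℝ (ℕ →ᵇ ℝ) where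
  carrier := {x | ∃ L : ℝ, Tendsto (fun n => x n) atTop (𝓝 L)}
  add_mem' := by
    rintro x y ⟨L, hL⟩ ⟨M, hM⟩
    exact ⟨L + M, by simpa using hL.add hM⟩
  zero_mem' := ⟨0, by simp⟩
  smul_mem' := by
    rintro a x ⟨L, hL⟩
    exact ⟨a * L, by simpa using hL.const_mul a⟩

/-- A linear isometry `T : X → Y` is a *U-embedding* if every norm-one functional on `X` has a
unique Hahn-Banach (norm-preserving) extension through `T`. -/
def IsUEmbedding {X Y : Type*} [NormedAddCommGroup X] [NormedSpace ℝ X]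
    [NormedAddCommGroup Y] [NormedSpace ℝ Y] (T : X →ₗᵢ[ℝ] Y) : Prop :=
  ∀ φ : StrongDual ℝ X, ‖φ‖ = 1 →
    ∃! ψ : StrongDual ℝ Y, ψ.comp T.toContinuousLinearMap = φ ∧ ‖ψ‖ = ‖φ‖

/-- A real normed space is *polyhedral* (Klee) if the closed unit ball of each of its
finite-dimensional subspaces is a polytope, that is, the convex hull of a finite set. -/
def IsPolyhedralSpace (X : Type*) [NormedAddCommGroup X] [NormedSpace ℝ X] : Prop :=
  ∀ E : Submodule ℝ X, FiniteDimensional ℝ E →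
    ∃ V : Set E, V.Finite ∧ Metric.closedBall (0 : E) 1 = convexHull ℝ V

/-- The space `M(K) = C(K)*` of regular signed Borel measures on a compact space `K`, as the dual
of `C(K)`, normed by the dual norm (the total variation). -/
abbrev MeasureSpaceDual (K : Type*) [TopologicalSpace K] [CompactSpace K] : Type _ :=
  StrongDual ℝ C(K, ℝ)

/-- The Dirac measure at `k`, as an element of `M(K)`. -/
noncomputable def diracFunctional {K : Type*} [TopologicalSpace K] [CompactSpace K] (k : K) :
    MeasureSpaceDual K :=
  ContinuousMap.evalCLM ℝ k

/-- The quadratic Bézier curve with control points `a`, `b`, `c`, at the parameter `s ∈ [0, 1]`. -/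
def quadBezier {V : Type*} [AddCommGroup V] [Module ℝ V] (a b c : V) (s : ℝ) : V :=
  (1 - s) ^ 2 • a + (2 * s * (1 - s)) • b + s ^ 2 • c

/-!
Let `F` map a compact space into the unit ball of `M(K)`, `w*`-continuously. A norm-preserving
extension through `T_F` of a norm-one functional vanishes at every `g` that is zero where `‖F t‖`
is `1`: for `‖x‖ ≤ 1` the bound `|⟨x, F t⟩| ≤ ‖F t‖` leaves room for a small multiple `c g` away
from that set, and `|g| ≤ ε` near it, so `‖T_F x + c g‖ ≤ 1 + c ε`. If `F` reaches the unit sphere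
only at Dirac measures, at points that form a copy of `K`, then every `g` agrees there with `T_F x`
for some `x`, and the extension is unique. For `K = ℕ ∪ {∞}` the middle control points
`p_n = n / (n + 1) • δ_n` have norm less than `1`, so the Bézier curves leave the unit sphere
between their end points, and they tend to `δ_∞`, so `F` is `w*`-continuous at `0`.
-/

section Polyhedral

variable {X Y : Type*} [NormedAddCommGroup X] [NormedSpace ℝ X]
  [NormedAddCommGroup Y] [NormedSpace ℝ Y]

theorem IsPolyhedralSpace.of_linearIsometry (hY : IsPolyhedralSpace Y) (i : X →ₗᵢ[ℝ] Y) :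
    IsPolyhedralSpace X := by
  intro E _
  let e : E ≃ₗᵢ[ℝ] E.map i.toLinearMap :=
    LinearIsometryEquiv.ofSurjective (i.submoduleMap E) (i.toLinearMap.submoduleMap_surjective E)
  obtain ⟨V, hVfin, hV⟩ := hY (E.map i.toLinearMap) inferInstance
  refine ⟨e.symm '' V, hVfin.image _, ?_⟩
  calc Metric.closedBall (0 : E) 1 = e.symm '' Metric.closedBall 0 1 := by
        rw [e.symm.image_closedBall, map_zero]
    _ = e.symm '' convexHull ℝ V := by rw [hV]
    _ = convexHull ℝ (e.symm '' V) := e.symm.toLinearEquiv.toLinearMap.image_convexHull V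

/-- By the maximum principle every functional that attains its norm on the ball of `E` does so at
one of the finitely many vertices, so infinitely many of them share a vertex. -/
theorem IsPolyhedralSpace.exists_infinite_setOf_apply_eq_one (hX : IsPolyhedralSpace X)
    (E : Submodule ℝ X) [FiniteDimensional ℝ E] {ι : Type*} [Infinite ι] {f : ι → StrongDual ℝ X}
    (hf : ∀ i, ‖f i‖ ≤ 1) (hE : ∀ i, ∃ z ∈ E, ‖z‖ ≤ 1 ∧ f i z = 1) :
    ∃ v ∈ E, {i | f i v = 1}.Infinite := by
  obtain ⟨V, hVfin, hV⟩ := hX E inferInstance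
  have hvertex_le (i : ι) {v : E} (hv : v ∈ V) : f i v ≤ 1 := by
    have hball : v ∈ Metric.closedBall (0 : E) 1 := hV ▸ subset_convexHull ℝ V hv
    exact (le_abs_self _).trans
      (((f i).unit_le_opNorm v (mem_closedBall_zero_iff.1 hball)).trans (hf i))
  have hvertex (i : ι) : ∃ v : V, f i v = 1 := by
    obtain ⟨z, hzE, hz, hfz⟩ := hE i
    have hzV : (⟨z, hzE⟩ : E) ∈ convexHull ℝ V := hV ▸ mem_closedBall_zero_iff.2 hz
    obtain ⟨v, hv, hzv⟩ := (((f i).toLinearMap ∘ₗ E.subtype).convexOn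
      convex_univ).exists_ge_of_mem_convexHull (subset_univ V) hzV
    exact ⟨⟨v, hv⟩, (hvertex_le i hv).antisymm (hfz.symm.trans_le hzv)⟩
  choose vertex hvertex using hvertex
  have : Finite V := hVfin
  obtain ⟨v, hv⟩ := Finite.exists_infinite_fiber vertex
  refine ⟨v, v.1.2, (infinite_coe_iff.1 hv).mono ?_⟩
  rintro i rfl
  exact hvertex i

end Polyhedral

theorem finite_setOf_mul_cos_add_mul_sin_eq_one {S : Set ℝ} (hS : Bornology.IsBounded S)
    (a b : ℝ) : {x ∈ S | a * Real.cos x + b * Real.sin x = 1}.Finite := by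
  by_contra hinf
  obtain ⟨x₀, -, hx₀⟩ := Set.Infinite.exists_accPt_of_subset_isCompact hinf hS.isCompact_closure
    ((sep_subset _ _).trans subset_closure)
  have hfreq : ∃ᶠ x in 𝓝[≠] x₀, a * Real.cos x + b * Real.sin x = 1 :=
    (accPt_iff_frequently_nhdsNE.1 hx₀).mono fun x hx => hx.2
  have hone : (fun x => a * Real.cos x + b * Real.sin x) = fun _ => 1 :=
    AnalyticOnNhd.eq_of_frequently_eq (fun x _ => by fun_prop) analyticOnNhd_const hfreq
  have h0 : a = 1 := by simpa using congrFun hone 0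
  have hπ : -a = 1 := by simpa using congrFun hone Real.pi
  linarith

section Dirac

variable {K : Type*} [TopologicalSpace K] [CompactSpace K]

theorem norm_diracFunctional_le_one (k : K) : ‖(diracFunctional k : MeasureSpaceDual K)‖ ≤ 1 :=
  ContinuousLinearMap.opNorm_le_bound _ zero_le_one fun f => by
    simpa using! f.norm_coe_le_norm k

/-- In the plane spanned by `cos ∘ f` and `sin ∘ f` the functionals `δ_k` act as points of a circle,
and `δ_k` is normed by `cos (f k) • cos ∘ f + sin (f k) • sin ∘ f = cos (f - f k)`. -/
theorem not_isPolyhedralSpace_continuousMap {f : C(K, ℝ)} (hf : (range f).Infinite) :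
    ¬ IsPolyhedralSpace C(K, ℝ) := by
  intro hpoly
  let c : C(K, ℝ) := ⟨fun k => Real.cos (f k), by fun_prop⟩
  let s : C(K, ℝ) := ⟨fun k => Real.sin (f k), by fun_prop⟩
  have : Infinite (range f) := hf.to_subtype
  have : FiniteDimensional ℝ (Submodule.span ℝ {c, s}) := .span_of_finite ℝ (by simp)
  obtain ⟨v, hv, hinf⟩ := hpoly.exists_infinite_setOf_apply_eq_one (Submodule.span ℝ {c, s})
    (f := fun y : range f => diracFunctional y.2.choose)
    (fun y => norm_diracFunctional_le_one _) fun y => by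
      set k := y.2.choose
      refine ⟨Real.cos (f k) • c + Real.sin (f k) • s, Submodule.mem_span_pair.2 ⟨_, _, rfl⟩,
        (ContinuousMap.norm_le _ zero_le_one).2 fun j => ?_, ?_⟩
      · change |Real.cos (f k) * Real.cos (f j) + Real.sin (f k) * Real.sin (f j)| ≤ 1
        rw [← Real.cos_sub]
        exact Real.abs_cos_le_one _
      · change Real.cos (f k) * Real.cos (f k) + Real.sin (f k) * Real.sin (f k) = 1
        rw [← Real.cos_sub, sub_self, Real.cos_zero]
  obtain ⟨a, b, rfl⟩ := Submodule.mem_span_pair.1 hv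
  refine hinf.image Subtype.val_injective.injOn
    ((finite_setOf_mul_cos_add_mul_sin_eq_one (isCompact_range f.continuous).isBounded a b).subset
      ?_)
  rintro _ ⟨y, hy, rfl⟩
  refine ⟨y.2, ?_⟩
  rw [← y.2.choose_spec]
  exact hy

end Dirac

section UEmbedding

theorem exists_strongDual_comp_eq_norm_eq {X Y : Type*} [NormedAddCommGroup X] [NormedSpace ℝ X]
    [NormedAddCommGroup Y] [NormedSpace ℝ Y] (T : X →ₗᵢ[ℝ] Y) (φ : StrongDual ℝ X) :
    ∃ ψ : StrongDual ℝ Y, ψ.comp T.toContinuousLinearMap = φ ∧ ‖ψ‖ = ‖φ‖ := by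
  obtain ⟨ψ, hψ, hnorm⟩ := exists_extension_norm_eq (LinearMap.range T.toLinearMap)
    (φ.comp (T.equivRange.symm : _ →L[ℝ] X))
  refine ⟨ψ, ContinuousLinearMap.ext fun x => ?_, ?_⟩
  · simpa using hψ (T.equivRange x)
  · rw [hnorm, ContinuousLinearMap.opNorm_comp_linearIsometryEquiv]

theorem IsUEmbedding.of_linearIsometryEquiv {X Y Z : Type*} [NormedAddCommGroup X]
    [NormedSpace ℝ X] [NormedAddCommGroup Y] [NormedSpace ℝ Y] [NormedAddCommGroup Z]
    [NormedSpace ℝ Z] {T : X →ₗᵢ[ℝ] Y} (hT : IsUEmbedding T) (e : Z ≃ₗᵢ[ℝ] X) {S : Z →ₗᵢ[ℝ] Y}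
    (hS : ∀ z, S z = T (e z)) : IsUEmbedding S := by
  intro φ hφ
  have hnorm : ‖φ.comp (e.symm : X →L[ℝ] Z)‖ = ‖φ‖ :=
    ContinuousLinearMap.opNorm_comp_linearIsometryEquiv φ e.symm
  have hcomp (ψ : StrongDual ℝ Y) : ψ.comp S.toContinuousLinearMap = φ ↔
      ψ.comp T.toContinuousLinearMap = φ.comp (e.symm : X →L[ℝ] Z) := by
    simp only [ContinuousLinearMap.ext_iff]
    exact ⟨fun h x => by simpa [hS] using h (e.symm x), fun h z => by simpa [hS] using h (e z)⟩
  simpa only [hcomp, hnorm] using hT _ (hnorm.trans hφ)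

variable {K : Type*} [TopologicalSpace K] [CompactSpace K] {r : K → ℝ} {g : C(K, ℝ)}

theorem exists_norm_add_smul_le (hr : UpperSemicontinuous r) (hg : ∀ t, 1 ≤ r t → g t = 0)
    {ε : ℝ} (hε : 0 < ε) :
    ∃ c > 0, ∀ f : C(K, ℝ), ‖f‖ ≤ 1 → (∀ t, |f t| ≤ r t) → ‖f + c • g‖ ≤ 1 + c * ε := by
  have hcompact : IsCompact {t | ε ≤ |g t|} :=
    (isClosed_le continuous_const g.continuous.abs).isCompact
  obtain ⟨δ, hδ, hrδ⟩ : ∃ δ > 0, ∀ t, ε ≤ |g t| → r t ≤ 1 - δ := by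
    rcases {t | ε ≤ |g t|}.eq_empty_or_nonempty with hempty | hne
    · exact ⟨1, one_pos, fun t ht => (hempty.subset ht).elim⟩
    · obtain ⟨t₀, ht₀, hmax⟩ := (hr.upperSemicontinuousOn _).exists_isMaxOn hne hcompact
      have hlt : r t₀ < 1 := by
        contrapose! hε
        simpa [hg t₀ hε] using ht₀
      exact ⟨1 - r t₀, sub_pos.2 hlt, fun t ht => by simpa using hmax ht⟩
  have hg' : 0 < ‖g‖ + 1 := by positivity
  refine ⟨δ / (‖g‖ + 1), div_pos hδ hg', fun f hf hfr => ?_⟩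
  set c := δ / (‖g‖ + 1)
  have hc0 : 0 < c := div_pos hδ hg'
  refine (ContinuousMap.norm_le _ (by positivity)).2 fun t => ?_
  have htri : |f t + c * g t| ≤ |f t| + c * |g t| := by
    simpa [abs_mul, abs_of_pos hc0] using abs_add_le (f t) (c * g t)
  refine htri.trans ?_
  rcases le_total ε |g t| with hfar | hnear
  · have hcg : c * |g t| ≤ δ := calc
      c * |g t| ≤ c * (‖g‖ + 1) := by
        gcongr
        exact (g.norm_coe_le_norm t).trans (le_add_of_nonneg_right zero_le_one)
      _ = δ := div_mul_cancel₀ δ hg'.ne'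
    linarith [hfr t, hrδ t hfar, mul_pos hc0 hε]
  · have hft : |f t| ≤ 1 := (f.norm_coe_le_norm t).trans hf
    gcongr

variable {X : Type*} [NormedAddCommGroup X] [NormedSpace ℝ X] {T : X →ₗᵢ[ℝ] C(K, ℝ)}

theorem apply_nonpos_of_norm_comp_eq (hr : UpperSemicontinuous r)
    (hT : ∀ t, ‖(diracFunctional t).comp T.toContinuousLinearMap‖ ≤ r t)
    {ψ : StrongDual ℝ C(K, ℝ)} (hψ : ‖ψ‖ = 1) (hψT : ‖ψ.comp T.toContinuousLinearMap‖ = 1)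
    (hg : ∀ t, 1 ≤ r t → g t = 0) : ψ g ≤ 0 := by
  refine le_of_forall_pos_le_add fun ε hε => ?_
  obtain ⟨c, hc, hbound⟩ := exists_norm_add_smul_le hr hg hε
  have hTx {x : X} (hx : ‖x‖ ≤ 1) : ψ (T x) + c * ψ g ≤ 1 + c * ε := calc
    ψ (T x) + c * ψ g = ψ (T x + c • g) := by simp
    _ ≤ ‖T x + c • g‖ := by
      simpa [hψ] using (le_abs_self _).trans (ψ.le_opNorm (T x + c • g))
    _ ≤ 1 + c * ε := hbound (T x) ((T.norm_map x).trans_le hx) fun t =>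
      (((diracFunctional t).comp T.toContinuousLinearMap).unit_le_opNorm x hx).trans (hT t)
  have hnorm : ‖ψ.comp T.toContinuousLinearMap‖ ≤ 1 + c * ε - c * ψ g := by
    refine ContinuousLinearMap.opNorm_le_of_unit_norm ?_ fun x hx => abs_le.2 ⟨?_, ?_⟩
    · simpa [sub_nonneg] using hTx (x := 0) (by simp)
    · have hneg := hTx (x := -x) (by simp [hx])
      simp only [map_neg] at hneg
      change -_ ≤ ψ (T x)
      linarith
    · change ψ (T x) ≤ _
      linarith [hTx hx.le]
  rw [hψT] at hnorm
  rw [zero_add]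
  exact le_of_mul_le_mul_left (by linarith) hc

theorem isUEmbedding_of_norm_le (hr : UpperSemicontinuous r)
    (hT : ∀ t, ‖(diracFunctional t).comp T.toContinuousLinearMap‖ ≤ r t)
    (hsurj : ∀ g : C(K, ℝ), ∃ x, ∀ t, 1 ≤ r t → T x t = g t) : IsUEmbedding T := by
  intro φ hφ
  obtain ⟨ψ, hψT, hψ⟩ := exists_strongDual_comp_eq_norm_eq T φ
  refine ⟨ψ, ⟨hψT, hψ⟩, ?_⟩
  have heq {χ : StrongDual ℝ C(K, ℝ)} (hχT : χ.comp T.toContinuousLinearMap = φ)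
      (hχ : ‖χ‖ = ‖φ‖) {g : C(K, ℝ)} {x : X} (hx : ∀ t, 1 ≤ r t → T x t = g t) : χ g = φ x := by
    have hle := apply_nonpos_of_norm_comp_eq hr hT (hχ.trans hφ) (hχT ▸ hφ) (g := g - T x)
      fun t ht => by simp [hx t ht]
    have hge := apply_nonpos_of_norm_comp_eq hr hT (hχ.trans hφ) (hχT ▸ hφ) (g := T x - g)
      fun t ht => by simp [hx t ht]
    rw [map_sub, sub_nonpos] at hle hge
    rw [← hχT]
    exact hle.antisymm hge
  rintro χ ⟨hχT, hχ⟩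
  ext g
  obtain ⟨x, hx⟩ := hsurj g
  rw [heq hχT hχ hx, heq hψT hψ hx]

end UEmbedding

section WeakStar

variable {K L : Type*} [TopologicalSpace K] [CompactSpace K] [TopologicalSpace L] [CompactSpace L]

/-- The operator `T_F : C(K) → C(L)`, `(T_F f) t = ⟨f, F t⟩`, given by a `w*`-continuous map `F`
into the unit ball of `M(K)`. It is an isometry because `F` takes every Dirac measure as a value. -/
def weakStarIsometry (F : L → MeasureSpaceDual K)
    (hF : Continuous fun t => StrongDual.toWeakDual (F t)) (hF_le : ∀ t, ‖F t‖ ≤ 1)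
    (hF_dirac : ∀ k, ∃ t, F t = diracFunctional k) : C(K, ℝ) →ₗᵢ[ℝ] C(L, ℝ) where
  toFun f := ⟨fun t => F t f, (WeakDual.eval_continuous f).comp hF⟩
  map_add' f g := ContinuousMap.ext fun t => map_add (F t) f g
  map_smul' a f := ContinuousMap.ext fun t => map_smul (F t) a f
  norm_map' f := by
    refine le_antisymm ((ContinuousMap.norm_le _ (norm_nonneg f)).2 fun t => ?_)
      ((ContinuousMap.norm_le _ (norm_nonneg _)).2 fun k => ?_)
    · exact ((F t).le_of_opNorm_le (hF_le t) f).trans_eq (one_mul _)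
    · obtain ⟨t, ht⟩ := hF_dirac k
      have hk : F t f = f k := by rw [ht]; rfl
      rw [← hk]
      exact ContinuousMap.norm_coe_le_norm (⟨fun t => F t f, _⟩ : C(L, ℝ)) t

variable {F : L → MeasureSpaceDual K}

theorem weakStarIsometry_apply (hF : Continuous fun t => StrongDual.toWeakDual (F t))
    (hF_le : ∀ t, ‖F t‖ ≤ 1) (hF_dirac : ∀ k, ∃ t, F t = diracFunctional k) (f : C(K, ℝ)) (t : L) :
    weakStarIsometry F hF hF_le hF_dirac f t = F t f := rfl

theorem isUEmbedding_weakStarIsometry (hF : Continuous fun t => StrongDual.toWeakDual (F t))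
    (hF_le : ∀ t, ‖F t‖ ≤ 1) {φ : C(K, L)} (hφ : ∀ k, F (φ k) = diracFunctional k) {r : L → ℝ}
    (hr : UpperSemicontinuous r) (hFr : ∀ t, ‖F t‖ ≤ r t) (hrφ : ∀ t, 1 ≤ r t → t ∈ range φ) :
    IsUEmbedding (weakStarIsometry F hF hF_le fun k => ⟨φ k, hφ k⟩) := by
  refine isUEmbedding_of_norm_le hr hFr fun g => ⟨g.comp φ, fun t ht => ?_⟩
  obtain ⟨k, rfl⟩ := hrφ t ht
  rw [weakStarIsometry_apply, hφ]
  rfl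

end WeakStar

section Bezier

variable {V W : Type*} [AddCommGroup V] [Module ℝ V] [AddCommGroup W] [Module ℝ W]

theorem quadBezier_zero (a b c : V) : quadBezier a b c 0 = a := by
  simp [quadBezier]

theorem quadBezier_one (a b c : V) : quadBezier a b c 1 = c := by
  simp [quadBezier]

theorem quadBezier_self (a : V) (s : ℝ) : quadBezier a a a s = a := by
  unfold quadBezier
  module

theorem quadBezier_one_left_right (w s : ℝ) :
    quadBezier 1 w 1 s = 1 - 2 * (s * (1 - s)) * (1 - w) := by
  simp only [quadBezier, smul_eq_mul]
  ring

theorem map_quadBezier (f : V →ₗ[ℝ] W) (a b c : V) (s : ℝ) :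
    f (quadBezier a b c s) = quadBezier (f a) (f b) (f c) s := by
  simp only [quadBezier, map_add, map_smul]

theorem continuous_uncurry_quadBezier [TopologicalSpace V] [ContinuousAdd V]
    [ContinuousSMul ℝ V] :
    Continuous fun q : (V × V × V) × ℝ => quadBezier q.1.1 q.1.2.1 q.1.2.2 q.2 := by
  unfold quadBezier
  fun_prop

theorem norm_quadBezier_le {V : Type*} [SeminormedAddCommGroup V] [NormedSpace ℝ V] {a b c : V}
    {A B C s : ℝ} (ha : ‖a‖ ≤ A) (hb : ‖b‖ ≤ B) (hc : ‖c‖ ≤ C) (hs : s ∈ Icc (0 : ℝ) 1) :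
    ‖quadBezier a b c s‖ ≤ quadBezier A B C s := by
  have hs' : 0 ≤ 2 * s * (1 - s) := mul_nonneg (by linarith [hs.1]) (sub_nonneg.2 hs.2)
  refine norm_add₃_le.trans ?_
  simp only [quadBezier, norm_smul, Real.norm_of_nonneg hs', Real.norm_of_nonneg (sq_nonneg _),
    smul_eq_mul]
  gcongr

end Bezier

section HarmonicGlue

/-- The point of `[1 / (n + 2), 1 / (n + 1)]` with affine parameter `s ∈ [0, 1]`. -/
noncomputable def harmonicPoint (n : ℕ) (s : ℝ) : ℝ :=
  (1 - s) * (1 / ((n : ℝ) + 2)) + s * (1 / ((n : ℝ) + 1))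

/-- The affine parameter of `t` in `[1 / (n + 2), 1 / (n + 1)]`, inverse to `harmonicPoint n`. -/
def harmonicParam (n : ℕ) (t : ℝ) : ℝ :=
  (n + 1) * ((n + 2) * t - 1)

/-- The number `n` of the interval `(1 / (n + 2), 1 / (n + 1)]` that contains `t ∈ (0, 1]`. -/
noncomputable def harmonicIndex (t : ℝ) : ℕ :=
  ⌊t⁻¹⌋₊ - 1

theorem harmonicPoint_zero (n : ℕ) : harmonicPoint n 0 = 1 / ((n : ℝ) + 2) := by
  simp [harmonicPoint]

theorem harmonicPoint_one (n : ℕ) : harmonicPoint n 1 = 1 / ((n : ℝ) + 1) := by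
  simp [harmonicPoint]

theorem harmonicPoint_succ_one (n : ℕ) : harmonicPoint (n + 1) 1 = harmonicPoint n 0 := by
  rw [harmonicPoint_one, harmonicPoint_zero]
  push_cast
  ring

theorem harmonicParam_harmonicPoint (n : ℕ) (s : ℝ) :
    harmonicParam n (harmonicPoint n s) = s := by
  unfold harmonicParam harmonicPoint
  field_simp
  ring

theorem harmonicPoint_harmonicParam (n : ℕ) (t : ℝ) :
    harmonicPoint n (harmonicParam n t) = t := by
  unfold harmonicParam harmonicPoint
  field_simp
  ring

theorem strictMono_harmonicPoint (n : ℕ) : StrictMono (harmonicPoint n) := by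
  intro s s' hs
  have hlt : 1 / ((n : ℝ) + 2) < 1 / ((n : ℝ) + 1) :=
    one_div_lt_one_div_of_lt (by positivity) (by linarith)
  unfold harmonicPoint
  nlinarith [mul_pos (sub_pos.2 hs) (sub_pos.2 hlt)]

theorem harmonicIndex_of_mem_Ioc {n : ℕ} {t : ℝ}
    (ht : t ∈ Ioc (1 / ((n : ℝ) + 2)) (1 / ((n : ℝ) + 1))) : harmonicIndex t = n := by
  have ht0 : 0 < t := lt_trans (by positivity) ht.1
  have hfloor : ⌊t⁻¹⌋₊ = n + 1 := by
    refine (Nat.floor_eq_iff (inv_nonneg.2 ht0.le)).2 ⟨?_, ?_⟩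
    · simpa using (le_one_div ht0 (by positivity)).1 ht.2
    · push_cast
      simpa [add_assoc, one_add_one_eq_two] using (one_div_lt (by positivity) ht0).1 ht.1
  rw [harmonicIndex, hfloor, Nat.add_sub_cancel]

theorem mem_Ioc_harmonicIndex {t : ℝ} (ht : t ∈ Ioc (0 : ℝ) 1) :
    t ∈ Ioc (1 / ((harmonicIndex t : ℝ) + 2)) (1 / ((harmonicIndex t : ℝ) + 1)) := by
  have hfloor : ((harmonicIndex t : ℝ) + 1) = ⌊t⁻¹⌋₊ := by
    have hpos : 1 ≤ ⌊t⁻¹⌋₊ := Nat.le_floor (by simpa using (one_le_inv₀ ht.1).2 ht.2)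
    exact_mod_cast Nat.sub_add_cancel hpos
  constructor
  · refine (one_div_lt (by positivity) ht.1).2 ?_
    have hlt := Nat.lt_floor_add_one t⁻¹
    rw [one_div]
    linarith
  · refine (le_one_div ht.1 (by positivity)).2 ?_
    rw [hfloor, one_div]
    exact Nat.floor_le (inv_nonneg.2 ht.1.le)

theorem harmonicParam_mem_Icc {n : ℕ} {t : ℝ}
    (ht : t ∈ Icc (1 / ((n : ℝ) + 2)) (1 / ((n : ℝ) + 1))) : harmonicParam n t ∈ Icc (0 : ℝ) 1 := by
  rw [← harmonicPoint_harmonicParam n t, ← harmonicPoint_zero, ← harmonicPoint_one] at ht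
  exact ⟨(strictMono_harmonicPoint n).le_iff_le.1 ht.1,
    (strictMono_harmonicPoint n).le_iff_le.1 ht.2⟩

theorem exists_harmonicPoint_eq {t : ℝ} (ht : t ∈ Icc (0 : ℝ) 1) :
    t = 0 ∨ ∃ n, ∃ s ∈ Ioc (0 : ℝ) 1, harmonicPoint n s = t := by
  rcases ht.1.eq_or_lt with rfl | ht0
  · exact .inl rfl
  have hmem := mem_Ioc_harmonicIndex ⟨ht0, ht.2⟩
  refine .inr ⟨_, _, ⟨?_, (harmonicParam_mem_Icc (Ioc_subset_Icc_self hmem)).2⟩,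
    harmonicPoint_harmonicParam _ t⟩
  rw [← (strictMono_harmonicPoint _).lt_iff_lt, harmonicPoint_harmonicParam, harmonicPoint_zero]
  exact hmem.1

variable {X : Type*} {a : X} {γ : ℕ → ℝ → X}

/-- The curve with value `a` at `0` that runs along `γ n` on `(1 / (n + 2), 1 / (n + 1)]`. -/
noncomputable def harmonicGlue (a : X) (γ : ℕ → ℝ → X) (t : ℝ) : X :=
  if t = 0 then a else γ (harmonicIndex t) (harmonicParam (harmonicIndex t) t)

theorem harmonicGlue_zero : harmonicGlue a γ 0 = a :=
  if_pos rfl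

theorem map_harmonicGlue {Y : Type*} (f : X → Y) (t : ℝ) :
    f (harmonicGlue a γ t) = harmonicGlue (f a) (fun n s => f (γ n s)) t :=
  apply_ite f _ _ _

theorem harmonicGlue_harmonicPoint (hγ : ∀ n, γ n 0 = γ (n + 1) 1) (n : ℕ) {s : ℝ}
    (hs : s ∈ Icc (0 : ℝ) 1) : harmonicGlue a γ (harmonicPoint n s) = γ n s := by
  have hpos (m : ℕ) {u : ℝ} (hu : u ∈ Ioc (0 : ℝ) 1) :
      harmonicGlue a γ (harmonicPoint m u) = γ m u := by
    have hmem : harmonicPoint m u ∈ Ioc (1 / ((m : ℝ) + 2)) (1 / ((m : ℝ) + 1)) := by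
      rw [← harmonicPoint_zero, ← harmonicPoint_one]
      exact ⟨strictMono_harmonicPoint m hu.1, (strictMono_harmonicPoint m).monotone hu.2⟩
    have hne : harmonicPoint m u ≠ 0 := (lt_trans (by positivity) hmem.1).ne'
    rw [harmonicGlue, if_neg hne, harmonicIndex_of_mem_Ioc hmem, harmonicParam_harmonicPoint]
  rcases hs.1.eq_or_lt with rfl | hs0
  · rw [← harmonicPoint_succ_one, hpos (n + 1) (by simp), hγ]
  · exact hpos n ⟨hs0, hs.2⟩

variable [TopologicalSpace X]

theorem continuousOn_harmonicGlue_Icc_one_div (hγ : ∀ n, γ n 0 = γ (n + 1) 1)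
    (hcont : ∀ n, ContinuousOn (γ n) (Icc 0 1)) (n : ℕ) :
    ContinuousOn (harmonicGlue a γ) (Icc (1 / ((n : ℝ) + 1)) 1) := by
  induction n with
  | zero => simp
  | succ n ih =>
    have hpiece :
        ContinuousOn (harmonicGlue a γ) (Icc (1 / ((n : ℝ) + 2)) (1 / ((n : ℝ) + 1))) := by
      refine ((hcont n).comp (f := harmonicParam n) (Continuous.continuousOn ?_)
        fun t ht => harmonicParam_mem_Icc ht).congr fun t ht => ?_
      · unfold harmonicParam
        fun_prop
      · rw [Function.comp_apply, ← harmonicGlue_harmonicPoint hγ n (harmonicParam_mem_Icc ht),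
          harmonicPoint_harmonicParam]
    have hunion := hpiece.union_of_isClosed ih isClosed_Icc isClosed_Icc
    have hle : 1 / ((n : ℝ) + 2) ≤ 1 / ((n : ℝ) + 1) := by gcongr; norm_num
    have hle_one : 1 / ((n : ℝ) + 1) ≤ 1 := by
      simpa using Nat.one_div_le_one_div (α := ℝ) n.zero_le
    rw [Icc_union_Icc_eq_Icc hle hle_one] at hunion
    simpa [add_assoc, one_add_one_eq_two] using hunion

theorem tendsto_harmonicIndex_nhdsGT_zero : Tendsto harmonicIndex (𝓝[>] 0) atTop :=
  (tendsto_sub_atTop_nat 1).comp (tendsto_nat_floor_atTop.comp tendsto_inv_nhdsGT_zero)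

theorem continuousWithinAt_harmonicGlue_zero
    (hlim : Tendsto (fun q : ℕ × ℝ => γ q.1 q.2) (atTop ×ˢ 𝓟 (Icc 0 1)) (𝓝 a)) :
    ContinuousWithinAt (harmonicGlue a γ) (Icc 0 1) 0 := by
  rw [← Ioc_insert_left zero_le_one, continuousWithinAt_insert_self, ContinuousWithinAt,
    harmonicGlue_zero]
  have hindex : Tendsto harmonicIndex (𝓝[Ioc 0 1] 0) atTop :=
    tendsto_harmonicIndex_nhdsGT_zero.mono_left (nhdsWithin_mono 0 Ioc_subset_Ioi_self)
  have hparam : Tendsto (fun t => harmonicParam (harmonicIndex t) t) (𝓝[Ioc 0 1] 0)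
      (𝓟 (Icc 0 1)) :=
    tendsto_principal.2 <| eventually_mem_nhdsWithin.mono fun t ht =>
      harmonicParam_mem_Icc (Ioc_subset_Icc_self (mem_Ioc_harmonicIndex ht))
  refine (hlim.comp (hindex.prodMk hparam)).congr' ?_
  filter_upwards [self_mem_nhdsWithin] with t ht
  exact (if_neg ht.1.ne').symm

theorem continuousOn_harmonicGlue (hγ : ∀ n, γ n 0 = γ (n + 1) 1)
    (hcont : ∀ n, ContinuousOn (γ n) (Icc 0 1))
    (hlim : Tendsto (fun q : ℕ × ℝ => γ q.1 q.2) (atTop ×ˢ 𝓟 (Icc 0 1)) (𝓝 a)) :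
    ContinuousOn (harmonicGlue a γ) (Icc 0 1) := by
  intro t ht
  rcases ht.1.eq_or_lt with rfl | ht0
  · exact continuousWithinAt_harmonicGlue_zero hlim
  obtain ⟨n, hn⟩ := exists_nat_one_div_lt ht0
  have hcontAt := continuousOn_harmonicGlue_Icc_one_div (a := a) hγ hcont n t ⟨hn.le, ht.2⟩
  refine hcontAt.mono_of_mem_nhdsWithin ?_
  filter_upwards [self_mem_nhdsWithin, mem_nhdsWithin_of_mem_nhds (Ioi_mem_nhds hn)] with u hu hnu
  exact ⟨(mem_Ioi.1 hnu).le, hu.2⟩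

end HarmonicGlue

section Spline

variable {V W : Type*} [AddCommGroup V] [Module ℝ V] [AddCommGroup W] [Module ℝ W] {L : V}
  {a b : ℕ → V}

/-- The curve on `[0, 1]` that starts at `L` and runs along the quadratic Bézier curve with control
points `a (n + 1)`, `b n`, `a n` on each interval `[1 / (n + 2), 1 / (n + 1)]`. -/
noncomputable def bezierSpline (L : V) (a b : ℕ → V) : ℝ → V :=
  harmonicGlue L fun n => quadBezier (a (n + 1)) (b n) (a n)

theorem bezierSpline_zero : bezierSpline L a b 0 = L :=
  harmonicGlue_zero

theorem quadBezier_segment_zero_eq_succ_one (n : ℕ) : quadBezier (a (n + 1)) (b n) (a n) 0 =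
    quadBezier (a (n + 1 + 1)) (b (n + 1)) (a (n + 1)) 1 := by
  rw [quadBezier_zero, quadBezier_one]

theorem bezierSpline_harmonicPoint (n : ℕ) {s : ℝ} (hs : s ∈ Icc (0 : ℝ) 1) :
    bezierSpline L a b (harmonicPoint n s) = quadBezier (a (n + 1)) (b n) (a n) s :=
  harmonicGlue_harmonicPoint quadBezier_segment_zero_eq_succ_one n hs

theorem bezierSpline_one_div (n : ℕ) : bezierSpline L a b (1 / ((n : ℝ) + 1)) = a n := by
  rw [← harmonicPoint_one, bezierSpline_harmonicPoint n (by simp), quadBezier_one]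

theorem map_bezierSpline (f : V →ₗ[ℝ] W) (t : ℝ) :
    f (bezierSpline L a b t) = bezierSpline (f L) (fun n => f (a n)) (fun n => f (b n)) t := by
  simp only [bezierSpline, map_harmonicGlue f, map_quadBezier]

theorem continuousOn_bezierSpline [TopologicalSpace V] [ContinuousAdd V] [ContinuousSMul ℝ V]
    (ha : Tendsto a atTop (𝓝 L)) (hb : Tendsto b atTop (𝓝 L)) :
    ContinuousOn (bezierSpline L a b) (Icc 0 1) := by
  have hcont (n : ℕ) : Continuous (quadBezier (a (n + 1)) (b n) (a n)) :=
    continuous_uncurry_quadBezier.comp (.prodMk_right (a (n + 1), b n, a n))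
  have hself : Tendsto (fun q : (V × V × V) × ℝ => quadBezier q.1.1 q.1.2.1 q.1.2.2 q.2)
      (𝓝 (L, L, L) ×ˢ 𝓝ˢ (Icc 0 1)) (𝓝 L) := by
    rw [← nhdsSet_singleton, ← isCompact_singleton.nhdsSet_prod_eq isCompact_Icc]
    refine continuous_uncurry_quadBezier.tendsto_nhdsSet_nhds ?_
    rintro ⟨_, s⟩ ⟨rfl, -⟩
    exact quadBezier_self L s
  have hctrl : Tendsto (fun n => (a (n + 1), b n, a n)) atTop (𝓝 (L, L, L)) :=
    ((tendsto_add_atTop_iff_nat 1).2 ha).prodMk_nhds (hb.prodMk_nhds ha)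
  have hparam : Tendsto id (𝓟 (Icc (0 : ℝ) 1)) (𝓝ˢ (Icc 0 1)) := principal_le_nhdsSet
  have hlim := hself.comp (hctrl.prodMap hparam)
  exact continuousOn_harmonicGlue quadBezier_segment_zero_eq_succ_one
    (fun n => (hcont n).continuousOn) hlim

theorem norm_bezierSpline_le {V : Type*} [SeminormedAddCommGroup V] [NormedSpace ℝ V] {L : V}
    {a b : ℕ → V} {L' : ℝ} {a' b' : ℕ → ℝ} (hL : ‖L‖ ≤ L') (ha : ∀ n, ‖a n‖ ≤ a' n)
    (hb : ∀ n, ‖b n‖ ≤ b' n) {t : ℝ} (ht : t ∈ Icc (0 : ℝ) 1) :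
    ‖bezierSpline L a b t‖ ≤ bezierSpline L' a' b' t := by
  rcases exists_harmonicPoint_eq ht with rfl | ⟨n, s, hs, rfl⟩
  · simpa only [bezierSpline_zero] using hL
  · simp only [bezierSpline_harmonicPoint n (Ioc_subset_Icc_self hs)]
    exact norm_quadBezier_le (ha _) (hb _) (ha _) (Ioc_subset_Icc_self hs)

variable {w : ℕ → ℝ} {t : ℝ}

theorem bezierSpline_one_le_one (hw : ∀ n, w n ≤ 1) (ht : t ∈ Icc (0 : ℝ) 1) :
    bezierSpline 1 1 w t ≤ 1 := by
  rcases exists_harmonicPoint_eq ht with rfl | ⟨n, s, hs, rfl⟩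
  · exact bezierSpline_zero.le
  · rw [bezierSpline_harmonicPoint n (Ioc_subset_Icc_self hs)]
    simp only [Pi.one_apply, quadBezier_one_left_right]
    have hs' : 0 ≤ s * (1 - s) := mul_nonneg hs.1.le (sub_nonneg.2 hs.2)
    nlinarith [mul_nonneg hs' (sub_nonneg.2 (hw n))]

theorem eq_zero_or_eq_one_div_of_one_le_bezierSpline (hw : ∀ n, w n < 1)
    (ht : t ∈ Icc (0 : ℝ) 1) (h : 1 ≤ bezierSpline 1 1 w t) :
    t = 0 ∨ ∃ n : ℕ, t = 1 / ((n : ℝ) + 1) := by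
  rcases exists_harmonicPoint_eq ht with rfl | ⟨n, s, hs, rfl⟩
  · exact .inl rfl
  · rw [bezierSpline_harmonicPoint n (Ioc_subset_Icc_self hs)] at h
    simp only [Pi.one_apply, quadBezier_one_left_right] at h
    have hs1 : s = 1 := by
      by_contra hne
      have hs' : 0 < s * (1 - s) := mul_pos hs.1 (sub_pos.2 (lt_of_le_of_ne hs.2 hne))
      nlinarith [mul_pos hs' (sub_pos.2 (hw n))]
    exact .inr ⟨n, by rw [hs1, harmonicPoint_one]⟩

end Spline

theorem tendsto_apply_natCast {X : Type*} [TopologicalSpace X] (f : C(OnePoint ℕ, X)) :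
    Tendsto (fun n : ℕ => f n) atTop (𝓝 (f OnePoint.infty)) :=
  (OnePoint.continuous_iff_from_nat f).1 f.continuous

/-- The sequence `(f n)` of values of `f ∈ C(ℕ ∪ {∞})` at the points of `ℕ`. -/
noncomputable def ConvSeq.ofContinuousMap : C(OnePoint ℕ, ℝ) →ₗᵢ[ℝ] ConvSeq where
  toFun f := ⟨(BoundedContinuousFunction.mkOfCompact f).compContinuous
    ⟨(↑), OnePoint.continuous_coe⟩, f OnePoint.infty, tendsto_apply_natCast f⟩
  map_add' _ _ := rfl
  map_smul' _ _ := rfl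
  norm_map' f := by
    set x := (BoundedContinuousFunction.mkOfCompact f).compContinuous
      ⟨((↑) : ℕ → OnePoint ℕ), OnePoint.continuous_coe⟩
    refine le_antisymm (BoundedContinuousFunction.norm_compContinuous_le _ _)
      ((ContinuousMap.norm_le f (norm_nonneg x)).2 fun k => ?_)
    induction k using OnePoint.rec with
    | infty => exact le_of_tendsto' (tendsto_apply_natCast f).norm x.norm_coe_le_norm
    | coe n => exact x.norm_coe_le_norm n

theorem ConvSeq.ofContinuousMap_apply (f : C(OnePoint ℕ, ℝ)) (n : ℕ) :
    (ofContinuousMap f).1 n = f n := rfl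

theorem ConvSeq.ofContinuousMap_surjective : Function.Surjective ofContinuousMap := by
  rintro ⟨x, L, hx⟩
  exact ⟨OnePoint.continuousMapMkNat x L hx, rfl⟩

/-- The canonical identification of `c` with `C(ℕ ∪ {∞})`. -/
noncomputable def convSeqEquiv : ConvSeq ≃ₗᵢ[ℝ] C(OnePoint ℕ, ℝ) :=
  (LinearIsometryEquiv.ofSurjective ConvSeq.ofContinuousMap
    ConvSeq.ofContinuousMap_surjective).symm

theorem convSeqEquiv_apply (x : ConvSeq) (n : ℕ) : convSeqEquiv x n = x.1 n := by
  rw [← ConvSeq.ofContinuousMap_apply]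
  exact congrArg (fun y : ConvSeq => y.1 n)
    (LinearIsometryEquiv.apply_symm_apply (LinearIsometryEquiv.ofSurjective _
      ConvSeq.ofContinuousMap_surjective) x)

/-- The embedding of `ℕ ∪ {∞}` into `[0, 1]` that sends `n` to `1 / (n + 1)` and `∞` to `0`. -/
noncomputable def harmonicNode : C(OnePoint ℕ, I) :=
  OnePoint.continuousMapMkNat
    (fun n => ⟨1 / ((n : ℝ) + 1), unitInterval.div_mem zero_le_one (by positivity) (by simp)⟩) 0
    (tendsto_subtype_rng.2 tendsto_one_div_add_atTop_nhds_zero_nat)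

theorem harmonicNode_natCast (n : ℕ) : (harmonicNode n : ℝ) = 1 / ((n : ℝ) + 1) := rfl

theorem not_isPolyhedralSpace_convSeq : ¬ IsPolyhedralSpace ConvSeq := by
  intro hpoly
  let f : C(OnePoint ℕ, ℝ) := ⟨fun k => harmonicNode k, by fun_prop⟩
  refine not_isPolyhedralSpace_continuousMap (f := f) ?_
    (hpoly.of_linearIsometry ConvSeq.ofContinuousMap)
  have hinj : Function.Injective fun n : ℕ => (1 : ℝ) / (n + 1) := fun m n h => by
    simpa using h
  refine (infinite_range_of_injective hinj).mono ?_
  rintro _ ⟨n, rfl⟩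
  exact ⟨n, harmonicNode_natCast n⟩

/-- The norm of the middle control point `p_n`. It is less than `1`, so that the curve meets the
unit sphere only at the Dirac measures, and tends to `1`, so that `p_n → δ_∞`. -/
noncomputable def controlWeight (n : ℕ) : ℝ :=
  n / (n + 1)

theorem controlWeight_nonneg (n : ℕ) : 0 ≤ controlWeight n := by
  unfold controlWeight
  positivity

theorem controlWeight_lt_one (n : ℕ) : controlWeight n < 1 :=
  (div_lt_one (by positivity)).2 (lt_add_one _)

theorem tendsto_controlWeight : Tendsto controlWeight atTop (𝓝 1) :=
  tendsto_natCast_div_add_atTop (1 : ℝ)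

/-- The middle control point `p_n` of the `n`-th Bézier curve. -/
noncomputable def controlPoint (n : ℕ) : MeasureSpaceDual (OnePoint ℕ) :=
  controlWeight n • diracFunctional (n : OnePoint ℕ)

theorem norm_controlPoint_le (n : ℕ) : ‖controlPoint n‖ ≤ controlWeight n :=
  ContinuousLinearMap.opNorm_le_bound _ (controlWeight_nonneg n) fun f => by
    have hfn : ‖f n‖ ≤ ‖f‖ := f.norm_coe_le_norm n
    change ‖controlWeight n * f n‖ ≤ controlWeight n * ‖f‖
    rw [norm_mul, Real.norm_of_nonneg (controlWeight_nonneg n)]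
    exact mul_le_mul_of_nonneg_left hfn (controlWeight_nonneg n)

/-- The curve `F` in the unit ball of `M(ℕ ∪ {∞})`. -/
noncomputable def diracCurve (t : I) : MeasureSpaceDual (OnePoint ℕ) :=
  bezierSpline (diracFunctional OnePoint.infty) (fun n : ℕ => diracFunctional (n : OnePoint ℕ))
    controlPoint t

/-- A majorant of `‖diracCurve t‖` that is less than `1` off the nodes. -/
noncomputable def diracCurveBound (t : I) : ℝ :=
  bezierSpline 1 1 controlWeight t

theorem diracCurve_harmonicNode (k : OnePoint ℕ) :
    diracCurve (harmonicNode k) = diracFunctional k := by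
  induction k using OnePoint.rec with
  | infty => exact bezierSpline_zero
  | coe n => exact bezierSpline_one_div n

theorem diracCurve_of_eq_harmonicPoint {n : ℕ} {t : I} {s : ℝ} (hs : s ∈ Icc (0 : ℝ) 1)
    (ht : (t : ℝ) = harmonicPoint n s) : diracCurve t =
      quadBezier (diracFunctional ((n + 1 : ℕ) : OnePoint ℕ)) (controlPoint n)
        (diracFunctional (n : OnePoint ℕ)) s := by
  rw [diracCurve, ht]
  exact bezierSpline_harmonicPoint n hs

theorem diracCurve_apply (t : I) (f : C(OnePoint ℕ, ℝ)) :
    diracCurve t f =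
      bezierSpline (f OnePoint.infty) (fun n : ℕ => f n) (fun n => controlWeight n * f n) t :=
  map_bezierSpline (ContinuousLinearMap.apply ℝ ℝ f).toLinearMap t

theorem continuous_toWeakDual_diracCurve :
    Continuous fun t => StrongDual.toWeakDual (diracCurve t) := by
  refine WeakDual.continuous_of_continuous_eval fun f => ?_
  have hf := tendsto_apply_natCast f
  have hwf : Tendsto (fun n : ℕ => controlWeight n * f n) atTop (𝓝 (f OnePoint.infty)) := by
    simpa only [one_mul] using tendsto_controlWeight.mul hf
  exact (continuousOn_iff_continuous_domRestrict.1 (continuousOn_bezierSpline hf hwf)).congr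
    fun t => (diracCurve_apply t f).symm

theorem continuous_diracCurveBound : Continuous diracCurveBound :=
  continuousOn_iff_continuous_domRestrict.1
    (continuousOn_bezierSpline tendsto_const_nhds tendsto_controlWeight)

theorem norm_diracCurve_le (t : I) : ‖diracCurve t‖ ≤ diracCurveBound t :=
  norm_bezierSpline_le (V := MeasureSpaceDual (OnePoint ℕ)) (norm_diracFunctional_le_one _)
    (fun _ => norm_diracFunctional_le_one _) norm_controlPoint_le t.2

theorem norm_diracCurve_le_one (t : I) : ‖diracCurve t‖ ≤ 1 :=
  (norm_diracCurve_le t).trans (bezierSpline_one_le_one (fun n => (controlWeight_lt_one n).le) t.2)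

theorem mem_range_harmonicNode_of_one_le_diracCurveBound {t : I} (ht : 1 ≤ diracCurveBound t) :
    t ∈ range harmonicNode := by
  rcases eq_zero_or_eq_one_div_of_one_le_bezierSpline controlWeight_lt_one t.2 ht with h0 | ⟨n, hn⟩
  · exact ⟨OnePoint.infty, Subtype.ext h0.symm⟩
  · exact ⟨n, Subtype.ext hn.symm⟩

/-- The operator `T_F : C(ℕ ∪ {∞}) → C[0, 1]` of the curve `F`. -/
noncomputable def diracCurveIsometry : C(OnePoint ℕ, ℝ) →ₗᵢ[ℝ] C(I, ℝ) :=
  weakStarIsometry diracCurve continuous_toWeakDual_diracCurve norm_diracCurve_le_one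
    fun k => ⟨harmonicNode k, diracCurve_harmonicNode k⟩

theorem isUEmbedding_diracCurveIsometry : IsUEmbedding diracCurveIsometry :=
  isUEmbedding_weakStarIsometry continuous_toWeakDual_diracCurve norm_diracCurve_le_one
    diracCurve_harmonicNode continuous_diracCurveBound.upperSemicontinuous norm_diracCurve_le
    fun _ => mem_range_harmonicNode_of_one_le_diracCurveBound

theorem mainTheorem10 :
    ¬ IsPolyhedralSpace ConvSeq ∧
    ∃ T : ConvSeq →ₗᵢ[ℝ] C(I, ℝ), IsUEmbedding (X := ConvSeq) (Y := C(I, ℝ)) T ∧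
      ∃ (e : ConvSeq ≃ₗᵢ[ℝ] C(OnePoint ℕ, ℝ))
        (F : I → MeasureSpaceDual (OnePoint ℕ))
        (p : ℕ → MeasureSpaceDual (OnePoint ℕ)),
        -- `e` is the canonical identification of `c` with `C(ℕ ∪ {∞})`
        (∀ (x : ConvSeq) (n : ℕ), e x (n : OnePoint ℕ) = x.1 n) ∧
        -- `F` is a weak-star continuous map into the unit ball, and `T` is the operator `T_F`
        Continuous (fun t => StrongDual.toWeakDual (F t)) ∧
        (∀ t, ‖F t‖ ≤ 1) ∧
        (∀ (x : ConvSeq) (t : I), T x t = F t (e x)) ∧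
        -- the values of `F`; the index `n : ℕ` starts at `0` and stands for the point `1 / (n + 1)`
        F 0 = diracFunctional (OnePoint.infty : OnePoint ℕ) ∧
        (∀ (n : ℕ) (t : I), (t : ℝ) = 1 / ((n : ℝ) + 1) →
          F t = diracFunctional (n : OnePoint ℕ)) ∧
        -- between consecutive points `1 / (n + 2)` and `1 / (n + 1)` it runs a Bézier curve
        (∀ n, ‖p n‖ < 1) ∧
        (∀ (n : ℕ) (t : I) (s : ℝ), s ∈ Set.Icc (0 : ℝ) 1 →
          (t : ℝ) = (1 - s) * (1 / ((n : ℝ) + 2)) + s * (1 / ((n : ℝ) + 1)) →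
          F t = quadBezier (diracFunctional ((n + 1 : ℕ) : OnePoint ℕ)) (p n)
            (diracFunctional (n : OnePoint ℕ)) s) := by
  refine ⟨not_isPolyhedralSpace_convSeq, diracCurveIsometry.comp convSeqEquiv.toLinearIsometry,
    isUEmbedding_diracCurveIsometry.of_linearIsometryEquiv (Z := ConvSeq) convSeqEquiv fun _ => rfl,
    convSeqEquiv, diracCurve, controlPoint, convSeqEquiv_apply, continuous_toWeakDual_diracCurve,
    norm_diracCurve_le_one, fun _ _ => rfl, diracCurve_harmonicNode OnePoint.infty,
    fun n t ht => ?_,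
    fun n => (norm_controlPoint_le n).trans_lt (controlWeight_lt_one n), fun n t s hs ht => ?_⟩
  · rw [Subtype.ext (ht.trans (harmonicNode_natCast n).symm), diracCurve_harmonicNode]
  · exact diracCurve_of_eq_harmonicPoint hs ht
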